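/- Let $k\ge 1$, let $M_k(\mathbb C)$ be the algebra of complex $k\times k$ matrices, $M_k^+(\mathbb C)$ its cone of positive semidefinite matrices, $\|a\|_1=\mathrm{tr}\,(a^*a)^{1/2}$ the trace norm, and $\mathcal G(\mathbb C^k)=\{\rho\in M_k^+(\mathbb C):\|\rho\|_1=1\}$ the set of density matrices. A channel is a completely positive, trace-preserving linear map $f:M_k(\mathbb C)\to M_k(\mathbb C)$; its dual $f^*$ is defined by $\mathrm{tr}(a\,f^*(b))=\mathrm{tr}(f(a)\,b)$ for all $a,b$. A linear map $f$ on $M_k(\mathbb C)$ is strictly positive if $f(a)$ is positive definite for every $a\in M_k^+(\mathbb C)\setminus\{0\}$. Let $(X,\mathscr A,\mathrm P)$ be a probability space and $T:X\to X$ a measure-preserving bijection with measurable inverse which is ergodic, i.e. $\mathrm P(A)\in\{0,1\}$ whenever $A\in\mathscr A$ and $T^{-1}(A)=A$. Let $f_0$ be an $\mathscr A$-measurable map on $X$ whose values are channels on $M_k(\mathbb C)$, and set $f_n(x)=f_0(T^n x)$ for $x\in X$, $n\in\mathbb Z$. Assume that there is a positive integer $N$ such that 1. $\mathrm P(f_N\circ\cdots\circ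 f_0\text{ is strictly positive})>0$, and 2. $\mathrm P(\ker(f_0^*)\cap M_k^+(\mathbb C)=\{0\})=1$. Then there are a (deterministic) number $\alpha>0$, an $\mathscr A$-measurable map $g_0:X\to\mathcal G(\mathbb C^k)$ and, for each $z\in\mathbb Z$, an $\mathscr A$-measurable function $C_{\alpha,z}:X\to[0,\infty]$ which is finite $\mathrm P$-almost surely, such that, with $g_n(x)=g_0(T^n x)$ for $n\in\mathbb Z$, for all $(m,z,n)\in\mathbb Z^3$ with $m<n$ and $m\le z\le n$ and at every $x \in X$, $$\|f_n\circ\cdots\circ f_m(\rho)-g_n\|_1\le C_{\alpha,z}\,e^{-\alpha(n-m)}\qquad\text{for all }\rho\in\mathcal G(\mathbb C^k).$$ -/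

import Mathlib

/-! Channels on the matrix algebra `M_k(ℂ)`, density matrices, and compositions of a two-sided
sequence of channels. -/

/-- `M_k(ℂ)`. -/
abbrev Mat (k : ℕ) : Type := Matrix (Fin k) (Fin k) ℂ

open scoped ComplexOrder

section Norms

open scoped MatrixOrder Matrix.Norms.L2Operator CStarAlgebra

/-- The trace norm `‖a‖₁ = tr |a|`, where `|a| = (a* a)^{1/2}`. -/
noncomputable def traceNorm {k : ℕ} (a : Mat k) : ℝ := (CFC.abs a).trace.re

/-- `f` is a channel on `M_k(ℂ)` (in the Schrödinger picture): completely positive and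
trace preserving. -/
def IsChannel {k : ℕ} (f : Mat k →ₗ[ℂ] Mat k) : Prop :=
  (∃ Φ : Mat k →CP Mat k, Φ.toLinearMap = f) ∧ ∀ a : Mat k, (f a).trace = a.trace

/-- Density matrices: `a ≥ 0` and `‖a‖₁ = 1`. -/
def IsDensity {k : ℕ} (a : Mat k) : Prop := a.PosSemidef ∧ traceNorm a = 1

theorem isDensity_iff {k : ℕ} (a : Mat k) : IsDensity a ↔ a.PosSemidef ∧ a.trace = 1 := by
  unfold IsDensity traceNorm
  refine and_congr_right fun h => ?_
  have hn : 0 ≤ a := Matrix.nonneg_iff_posSemidef.mpr h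
  rw [CFC.abs_of_nonneg a hn]
  have him : a.trace.im = 0 := (Complex.nonneg_iff.mp h.trace_nonneg).2.symm
  constructor
  · intro h1
    exact Complex.ext (by simpa using h1) (by simpa using him)
  · intro h1
    simp [h1]

end Norms

/-- The dual `f*` of a linear map `f` on `M_k(ℂ)` with respect to the trace pairing: the linear map
with `tr (a f*(b)) = tr (f(a) b)` for all `a` and `b`, see `trace_mul_dualMap`. -/
noncomputable def dualMap {k : ℕ} (f : Mat k →ₗ[ℂ] Mat k) : Mat k →ₗ[ℂ] Mat k where
  toFun b := Matrix.of fun j i => (f (Matrix.single i j 1) * b).trace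
  map_add' b c := by
    ext i j
    simp [Matrix.mul_add]
  map_smul' r b := by
    ext i j
    simp

theorem trace_mul_dualMap {k : ℕ} (f : Mat k →ₗ[ℂ] Mat k) (a b : Mat k) :
    (a * dualMap f b).trace = (f a * b).trace := by
  conv_rhs => rw [Matrix.matrix_eq_sum_single a]
  have h : ∀ i j, f (Matrix.single i j (a i j)) = a i j • f (Matrix.single i j 1) := by
    intro i j
    rw [← map_smul, Matrix.smul_single, smul_eq_mul, mul_one]
  simp only [map_sum, h, Finset.sum_mul, Matrix.trace_sum, Matrix.smul_mul, Matrix.trace_smul,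
    smul_eq_mul]
  simp [Matrix.trace, Matrix.mul_apply, dualMap]

/-- A map `f` on `M_k(ℂ)` is strictly positive if `f(a) > 0` (positive definite) for every nonzero
positive semidefinite `a`. -/
def IsStrictPos {k : ℕ} (f : Mat k →ₗ[ℂ] Mat k) : Prop :=
  ∀ a : Mat k, a.PosSemidef → a ≠ 0 → (f a).PosDef

/-- `compUp F m j = F (m + j) ∘ ⋯ ∘ F (m + 1) ∘ F m`. -/
def compUp {k : ℕ} (F : ℤ → (Mat k →ₗ[ℂ] Mat k)) (m : ℤ) : ℕ → (Mat k →ₗ[ℂ] Mat k)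
  | 0 => F m
  | j + 1 => F (m + (j + 1 : ℕ)) ∘ₗ compUp F m j

/-- `compRange F n m = F n ∘ ⋯ ∘ F m`, for `m ≤ n`. -/
def compRange {k : ℕ} (F : ℤ → (Mat k →ₗ[ℂ] Mat k)) (n m : ℤ) : Mat k →ₗ[ℂ] Mat k :=
  compUp F m (n - m).toNat

/-- The two-sided sequence `h_n(x) = h₀(Tⁿ x)`, `n ∈ ℤ`, generated by `h₀` along `T`. -/
def orbitSeq {X Y : Type*} [MeasurableSpace X] (T : X ≃ᵐ X) (h₀ : X → Y) (n : ℤ) (x : X) : Y :=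
  h₀ ((T.toEquiv ^ n : Equiv.Perm X) x)

/-- Measurability of a matrix valued map (for the Borel `σ`-algebra of `M_k(ℂ)`), entrywise. -/
def MatMeasurable {X : Type*} [MeasurableSpace X] {k : ℕ} (g : X → Mat k) : Prop :=
  ∀ i j, Measurable fun x => g x i j

/-- Measurability of a map into the linear maps on `M_k(ℂ)` (for the Borel `σ`-algebra of this
finite dimensional space): all evaluations are measurable. -/
def MapMeasurable {X : Type*} [MeasurableSpace X] {k : ℕ} (f : X → (Mat k →ₗ[ℂ] Mat k)) : Prop :=
  ∀ a : Mat k, MatMeasurable fun x => f x a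

/-!
If `f_N ∘ ⋯ ∘ f_0` is strictly positive, it dominates a multiple `ε tr(·) 1` of the depolarizing map
(compactness of the set of states), hence it shrinks the trace distance of states by the factor
`1 - kε ≤ exp (-kε)` (Doeblin's argument). For some `ε > 0` this happens with positive probability,
so along an orbit of `n` points the composition contracts by `exp (C + S_n ψ)`, where `S_n ψ` are
the Birkhoff sums of a function `ψ ≤ 0` with `∫ ψ < 0`.

For `0 < α < -∫ ψ` the function `φ = ψ + α` still has negative integral. By the maximal ergodic
theorem, applied to `T` and to `T⁻¹`, the sums of `φ` over the orbit segments through a given point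
are almost surely bounded above by a finite `S`, so that compositions along these segments contract
by `exp (C + S) e^{-αn}`, with `C + S` depending only on the point. The images of the set of states
under compositions that start ever further in the past are nested and of diameter tending to `0`,
and the state in which they meet is equivariant. Comparing with it gives the estimate.
-/

section TraceNorm

open Matrix
open scoped MatrixOrder Matrix.Norms.L2Operator CStarAlgebra

variable {n : Type*} [Fintype n]

theorem re_trace_mul_nonneg {a b : Matrix n n ℂ} (ha : a.PosSemidef) (hb : b.PosSemidef) :
    0 ≤ (a * b).trace.re := by
  classical
  obtain ⟨c, rfl⟩ := CStarAlgebra.nonneg_iff_eq_star_mul_self.mp hb.nonneg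
  rw [← Matrix.mul_assoc, Matrix.trace_mul_comm, ← Matrix.mul_assoc]
  exact (Complex.nonneg_iff.mp (ha.mul_mul_conjTranspose_same c).trace_nonneg).1

variable [DecidableEq n]

theorem norm_le_re_trace {a : Matrix n n ℂ} (ha : a.PosSemidef) : ‖a‖ ≤ a.trace.re := by
  have hsum : a.trace.re = ∑ i, ha.isHermitian.eigenvalues i := by
    simp [ha.isHermitian.trace_eq_sum_eigenvalues]
  rw [CStarAlgebra.norm_le_iff_le_algebraMap a (Complex.nonneg_iff.mp ha.trace_nonneg).1 ha.nonneg,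
    le_algebraMap_iff_spectrum_le ha.isHermitian, ha.isHermitian.spectrum_real_eq_range_eigenvalues,
    hsum]
  rintro _ ⟨i, rfl⟩
  exact Finset.single_le_sum (fun j _ => ha.eigenvalues_nonneg j) (Finset.mem_univ i)

theorem re_trace_mul_le_re_trace {a b : Matrix n n ℂ} (ha : a ≤ 1) (hb : b.PosSemidef) :
    (a * b).trace.re ≤ b.trace.re := by
  have h := re_trace_mul_nonneg (Matrix.le_iff.mp ha) hb
  rwa [Matrix.sub_mul, Matrix.one_mul, Matrix.trace_sub, Complex.sub_re, sub_nonneg] at h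

theorem exists_abs_eq_mul {a : Matrix n n ℂ} (ha : IsSelfAdjoint a) :
    ∃ s : Matrix n n ℂ, s ≤ 1 ∧ -s ≤ 1 ∧ CFC.abs a = s * a := by
  have hc (f : ℝ → ℝ) : ContinuousOn f (spectrum ℝ a) := a.finite_real_spectrum.continuousOn f
  refine ⟨cfc (fun x : ℝ => (SignType.sign x : ℝ)) a, ?_, ?_, ?_⟩
  · refine cfc_le_one _ a fun x _ => ?_
    cases SignType.sign x <;> norm_num
  · rw [← cfc_neg]
    refine cfc_le_one _ a fun x _ => ?_
    cases SignType.sign x <;> norm_num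
  · rw [CFC.abs_eq_cfc_norm a ha]
    have h := cfc_mul (fun x : ℝ => (SignType.sign x : ℝ)) (fun x => x) a (hc _) (hc _)
    rw [cfc_id' ℝ a ha] at h
    simpa only [sign_mul_self, Real.norm_eq_abs] using h

variable {k : ℕ} {a b ρ σ : Mat k}

theorem norm_le_traceNorm (a : Mat k) : ‖a‖ ≤ traceNorm a := by
  rw [← CFC.norm_abs]
  exact norm_le_re_trace (CFC.abs_nonneg a).posSemidef

theorem traceNorm_nonneg (a : Mat k) : 0 ≤ traceNorm a :=
  (norm_nonneg a).trans (norm_le_traceNorm a)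

theorem traceNorm_sub_le (ha : a.PosSemidef) (hb : b.PosSemidef) :
    traceNorm (a - b) ≤ a.trace.re + b.trace.re := by
  obtain ⟨s, hs, hs', h_abs⟩ := exists_abs_eq_mul (ha.isHermitian.sub hb.isHermitian)
  calc traceNorm (a - b) = (s * a).trace.re + (-s * b).trace.re := by
        rw [traceNorm, h_abs, Matrix.mul_sub, Matrix.trace_sub, Matrix.neg_mul, Matrix.trace_neg,
          Complex.sub_re, Complex.neg_re, sub_eq_add_neg]
    _ ≤ a.trace.re + b.trace.re :=
        add_le_add (re_trace_mul_le_re_trace hs ha) (re_trace_mul_le_re_trace hs' hb)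

theorem exists_posSemidef_sub_eq (ha : a.IsHermitian) :
    ∃ p q : Mat k, p.PosSemidef ∧ q.PosSemidef ∧ p - q = a ∧
      traceNorm a = p.trace.re + q.trace.re := by
  refine ⟨a⁺, a⁻, (CFC.posPart_nonneg a).posSemidef, (CFC.negPart_nonneg a).posSemidef,
    CFC.posPart_sub_negPart a ha, ?_⟩
  rw [traceNorm, ← CFC.posPart_add_negPart a ha, Matrix.trace_add, Complex.add_re]

theorem IsDensity.posSemidef (hρ : IsDensity ρ) : ρ.PosSemidef := hρ.1

theorem IsDensity.trace_eq_one (hρ : IsDensity ρ) : ρ.trace = 1 := ((isDensity_iff ρ).mp hρ).2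

theorem IsDensity.traceNorm_sub_le_two (hρ : IsDensity ρ) (hσ : IsDensity σ) :
    traceNorm (ρ - σ) ≤ 2 := by
  refine (traceNorm_sub_le hρ.posSemidef hσ.posSemidef).trans_eq ?_
  rw [hρ.trace_eq_one, hσ.trace_eq_one, Complex.one_re, one_add_one_eq_two]

theorem isDensity_inv_trace_smul (ha : a.PosSemidef) (ha₀ : a ≠ 0) :
    IsDensity (a.trace⁻¹ • a) := by
  rw [isDensity_iff, Matrix.trace_smul, smul_eq_mul,
    inv_mul_cancel₀ (mt ha.trace_eq_zero_iff.mp ha₀)]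
  exact ⟨ha.smul (inv_nonneg.mpr ha.trace_nonneg), rfl⟩

theorem exists_isDensity (hk : 0 < k) : ∃ ρ : Mat k, IsDensity ρ := by
  have : Nonempty (Fin k) := ⟨⟨0, hk⟩⟩
  exact ⟨_, isDensity_inv_trace_smul Matrix.PosSemidef.one one_ne_zero⟩

theorem isClosed_posSemidef {n : Type*} [Finite n] :
    IsClosed {a : Matrix n n ℂ | a.PosSemidef} := by
  classical
  have := Fintype.ofFinite n
  simp only [← Matrix.nonneg_iff_posSemidef]
  exact CStarAlgebra.isClosed_nonneg

theorem isClosed_isDensity (k : ℕ) : IsClosed {ρ : Mat k | IsDensity ρ} := by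
  simp only [isDensity_iff]
  exact isClosed_posSemidef.inter (isClosed_eq (by fun_prop) continuous_const)

theorem isCompact_isDensity (k : ℕ) : IsCompact {ρ : Mat k | IsDensity ρ} := by
  have : ProperSpace (Mat k) := FiniteDimensional.proper ℂ (Mat k)
  refine (isCompact_closedBall (0 : Mat k) 1).of_isClosed_subset (isClosed_isDensity k)
    fun ρ hρ => ?_
  exact mem_closedBall_zero_iff.mpr ((norm_le_traceNorm ρ).trans_eq hρ.2)

end TraceNorm

section Doeblin

open Matrix Set Topology MeasureTheory
open scoped MatrixOrder Matrix.Norms.L2Operator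

theorem exists_pos_algebraMap_le_of_isCompact {A : Type*} [CStarAlgebra A] [PartialOrder A]
    [StarOrderedRing A] {K : Set A} (hK : IsCompact K) (hpos : ∀ a ∈ K, IsStrictlyPositive a) :
    ∃ r : ℝ, 0 < r ∧ ∀ a ∈ K, algebraMap ℝ A r ≤ a := by
  cases subsingleton_or_nontrivial A
  · exact ⟨1, one_pos, fun a _ => (Subsingleton.elim _ a).le⟩
  suffices hloc : ∀ a ∈ K, ∃ t ∈ 𝓝[K] a, ∃ r : ℝ, 0 < r ∧ ∀ b ∈ t, algebraMap ℝ A r ≤ b by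
    refine hK.induction_on ⟨1, one_pos, by simp⟩ ?_ ?_ hloc
    · rintro s t hst ⟨r, hr, ht⟩
      exact ⟨r, hr, fun b hb => ht b (hst hb)⟩
    · rintro s t ⟨r, hr, hs⟩ ⟨r', hr', ht⟩
      refine ⟨min r r', lt_min hr hr', ?_⟩
      rintro b (hb | hb)
      · exact (algebraMap_mono A (min_le_left r r')).trans (hs b hb)
      · exact (algebraMap_mono A (min_le_right r r')).trans (ht b hb)
  intro a ha
  obtain ⟨r, hr, hra⟩ := (CFC.exists_pos_algebraMap_le_iff (hpos a ha).isSelfAdjoint).mpr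
    fun x hx => (hpos a ha).spectrum_pos hx
  refine ⟨Metric.ball a (r / 2) ∩ K, inter_comm K _ ▸ inter_mem_nhdsWithin K
    (Metric.ball_mem_nhds a (half_pos hr)), r / 2, half_pos hr, ?_⟩
  rintro b ⟨hba, hb⟩
  have hdiff : -algebraMap ℝ A (r / 2) ≤ b - a :=
    (neg_le_neg (algebraMap_mono A (mem_ball_iff_norm.mp hba).le)).trans
      ((hpos b hb).isSelfAdjoint.sub (hpos a ha).isSelfAdjoint).neg_algebraMap_norm_le_self
  calc algebraMap ℝ A (r / 2) = -algebraMap ℝ A (r / 2) + algebraMap ℝ A r := by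
        rw [← map_neg, ← map_add]; congr 1; ring
    _ ≤ b - a + a := add_le_add hdiff hra
    _ = b := sub_add_cancel b a

variable {k : ℕ} {f g : Mat k →ₗ[ℂ] Mat k} {a ρ : Mat k} {κ κ' ε ε' : ℝ}

/-- Positive trace-preserving maps of `M_k(ℂ)`; the completely positive ones are the channels. -/
structure IsPositiveTracePreserving (f : Mat k →ₗ[ℂ] Mat k) : Prop where
  map_posSemidef : ∀ a : Mat k, a.PosSemidef → (f a).PosSemidef
  trace_map : ∀ a : Mat k, (f a).trace = a.trace

theorem IsChannel.isPositiveTracePreserving (hf : IsChannel f) :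
    IsPositiveTracePreserving f := by
  obtain ⟨⟨Φ, rfl⟩, htr⟩ := hf
  exact ⟨fun a ha => (map_nonneg Φ ha.nonneg).posSemidef, htr⟩

namespace IsPositiveTracePreserving

theorem id : IsPositiveTracePreserving (LinearMap.id : Mat k →ₗ[ℂ] Mat k) :=
  ⟨fun _ ha => ha, fun _ => rfl⟩

theorem comp (hf : IsPositiveTracePreserving f) (hg : IsPositiveTracePreserving g) :
    IsPositiveTracePreserving (f ∘ₗ g) :=
  ⟨fun a ha => hf.map_posSemidef _ (hg.map_posSemidef a ha),
    fun a => (hf.trace_map _).trans (hg.trace_map a)⟩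

theorem map_isDensity (hf : IsPositiveTracePreserving f) (hρ : IsDensity ρ) :
    IsDensity (f ρ) :=
  (isDensity_iff _).mpr ⟨hf.map_posSemidef ρ hρ.posSemidef, (hf.trace_map ρ).trans hρ.trace_eq_one⟩

end IsPositiveTracePreserving

/-- `f` shrinks the trace distance of density matrices by the factor `κ`. -/
def Contracts (f : Mat k →ₗ[ℂ] Mat k) (κ : ℝ) : Prop :=
  ∀ ρ σ : Mat k, IsDensity ρ → IsDensity σ → traceNorm (f ρ - f σ) ≤ κ * traceNorm (ρ - σ)

/-- Doeblin's minorization: `f` dominates `ε` times the completely depolarizing map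
`a ↦ tr(a) 1` on the positive cone. -/
def Minorizes (f : Mat k →ₗ[ℂ] Mat k) (ε : ℝ) : Prop :=
  ∀ a : Mat k, a.PosSemidef → (f a - ((ε : ℂ) * a.trace) • (1 : Mat k)).PosSemidef

theorem Contracts.mono (hf : Contracts f κ) (h : κ ≤ κ') : Contracts f κ' := fun ρ σ hρ hσ =>
  (hf ρ σ hρ hσ).trans (mul_le_mul_of_nonneg_right h (traceNorm_nonneg _))

theorem Contracts.comp (hf : Contracts f κ) (hg : Contracts g κ') (hκ : 0 ≤ κ)
    (hgd : ∀ ρ, IsDensity ρ → IsDensity (g ρ)) : Contracts (f ∘ₗ g) (κ * κ') :=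
  fun ρ σ hρ hσ => calc
    traceNorm (f (g ρ) - f (g σ)) ≤ κ * traceNorm (g ρ - g σ) := hf _ _ (hgd ρ hρ) (hgd σ hσ)
    _ ≤ κ * (κ' * traceNorm (ρ - σ)) := mul_le_mul_of_nonneg_left (hg ρ σ hρ hσ) hκ
    _ = κ * κ' * traceNorm (ρ - σ) := (mul_assoc _ _ _).symm

theorem Contracts.traceNorm_sub_le (hf : Contracts f κ) (hκ : 0 ≤ κ) {σ : Mat k}
    (hρ : IsDensity ρ) (hσ : IsDensity σ) : traceNorm (f ρ - f σ) ≤ 2 * κ :=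
  (hf ρ σ hρ hσ).trans ((mul_le_mul_of_nonneg_left (hρ.traceNorm_sub_le_two hσ) hκ).trans_eq
    (mul_comm _ _))

-- On the traceless part `p - q` of a difference of states, subtracting `ε tr(·) 1` from `f` changes
-- nothing, while it lowers the traces of `f p` and `f q` by the factor `1 - kε`.
theorem Minorizes.contracts (hf : Minorizes f ε) (htr : ∀ a, (f a).trace = a.trace) :
    Contracts f (1 - k * ε) := by
  intro ρ σ hρ hσ
  obtain ⟨p, q, hp, hq, hpq, h_norm⟩ :=
    exists_posSemidef_sub_eq (hρ.posSemidef.isHermitian.sub hσ.posSemidef.isHermitian)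
  have h_trace : p.trace = q.trace := by
    rw [← sub_eq_zero, ← Matrix.trace_sub, hpq, Matrix.trace_sub, hρ.trace_eq_one,
      hσ.trace_eq_one, sub_self]
  set f' : Mat k → Mat k := fun a => f a - ((ε : ℂ) * a.trace) • (1 : Mat k) with hf'
  have h_trace' (a : Mat k) : (f' a).trace.re = (1 - k * ε) * a.trace.re := by
    rw [hf', Matrix.trace_sub, htr, Matrix.trace_smul, Matrix.trace_one, Fintype.card_fin]
    simp only [smul_eq_mul, Complex.sub_re, Complex.mul_re, Complex.mul_im, Complex.ofReal_re,
      Complex.ofReal_im, Complex.natCast_re, Complex.natCast_im]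
    ring
  have h_split : f ρ - f σ = f' p - f' q := by
    simp only [hf', ← map_sub, ← hpq, h_trace, sub_sub_sub_cancel_right]
  calc traceNorm (f ρ - f σ) ≤ (f' p).trace.re + (f' q).trace.re :=
        h_split ▸ _root_.traceNorm_sub_le (hf p hp) (hf q hq)
    _ = (1 - k * ε) * traceNorm (ρ - σ) := by rw [h_trace', h_trace', h_norm, mul_add]

theorem Minorizes.mono (hf : Minorizes f ε) (h : ε' ≤ ε) : Minorizes f ε' := by
  intro a ha
  have h_smul : (((ε - ε' : ℝ) * a.trace) • (1 : Mat k)).PosSemidef :=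
    Matrix.PosSemidef.one.smul
      (mul_nonneg (Complex.zero_le_real.mpr (sub_nonneg.mpr h)) ha.trace_nonneg)
  convert (hf a ha).add h_smul using 1
  rw [Complex.ofReal_sub, sub_mul, sub_smul, sub_add_sub_cancel]

theorem IsPositiveTracePreserving.contracts_one (hf : IsPositiveTracePreserving f) :
    Contracts f 1 := by
  have h_zero : Minorizes f 0 := fun a ha => by simpa using hf.map_posSemidef a ha
  simpa using h_zero.contracts hf.trace_map

theorem IsStrictPos.exists_minorizes (hf : IsStrictPos f) : ∃ ε : ℝ, 0 < ε ∧ Minorizes f ε := by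
  have h_compact : IsCompact (f '' {ρ | IsDensity ρ}) :=
    (isCompact_isDensity k).image f.continuous_of_finiteDimensional
  obtain ⟨ε, hε, h_le⟩ := exists_pos_algebraMap_le_of_isCompact h_compact <| by
    rintro _ ⟨ρ, hρ, rfl⟩
    refine (hf ρ hρ.posSemidef ?_).isStrictlyPositive
    rintro rfl
    simpa using hρ.trace_eq_one
  refine ⟨ε, hε, fun a ha => ?_⟩
  obtain rfl | ha₀ := eq_or_ne a 0
  · simpa using Matrix.PosSemidef.zero
  have h_trace : a.trace ≠ 0 := mt ha.trace_eq_zero_iff.mp ha₀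
  have h_density := h_le _ (mem_image_of_mem f (isDensity_inv_trace_smul ha ha₀))
  have h_normalize : f a - ((ε : ℂ) * a.trace) • (1 : Mat k) =
      a.trace • (f (a.trace⁻¹ • a) - algebraMap ℝ (Mat k) ε) := by
    rw [map_smul, smul_sub, smul_inv_smul₀ h_trace, mul_comm, mul_smul,
      Algebra.algebraMap_eq_smul_one, Complex.coe_smul]
  rw [h_normalize]
  exact (Matrix.le_iff.mp h_density).smul ha.trace_nonneg

theorem exists_pos_measure_minorizes {X : Type*} [MeasurableSpace X] {μ : Measure X}
    {h : X → (Mat k →ₗ[ℂ] Mat k)} (hpos : 0 < μ {x | IsStrictPos (h x)}) :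
    ∃ ε : ℝ, 0 < ε ∧ 0 < μ {x | Minorizes (h x) ε} := by
  have h_subset : {x | IsStrictPos (h x)} ⊆ ⋃ n : ℕ, {x | Minorizes (h x) (1 / ((n : ℝ) + 1))} := by
    intro x hx
    obtain ⟨ε, hε, hm⟩ := IsStrictPos.exists_minorizes hx
    obtain ⟨n, hn⟩ := exists_nat_one_div_lt hε
    exact mem_iUnion.mpr ⟨n, hm.mono hn.le⟩
  obtain ⟨n, hn⟩ := exists_measure_pos_of_not_measure_iUnion_null
    (hpos.trans_le (measure_mono h_subset)).ne'
  exact ⟨_, Nat.one_div_pos_of_nat, hn⟩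

end Doeblin

section MaximalErgodic

open MeasureTheory Filter Topology

variable {X : Type*} {T : X → X} {φ : X → ℝ} {x : X}

/-- The running maximum `max_{0 ≤ i ≤ n} S_i φ(x)` of the Birkhoff sums along the orbit of `x`. -/
noncomputable def birkhoffMax (T : X → X) (φ : X → ℝ) (n : ℕ) (x : X) : ℝ :=
  partialSups (fun i => birkhoffSum T φ i x) n

/-- The points along whose orbits the Birkhoff sums of `φ` are bounded above. -/
def birkhoffBddAbove (T : X → X) (φ : X → ℝ) : Set X :=
  {x | BddAbove (Set.range fun n => birkhoffSum T φ n x)}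

theorem birkhoffMax_succ (n : ℕ) (x : X) :
    birkhoffMax T φ (n + 1) x = max 0 (φ x + birkhoffMax T φ n (T x)) := by
  have h_shift := map_partialSups (OrderIso.addLeft (φ x)) (fun i => birkhoffSum T φ i (T x)) n
  simp only [OrderIso.addLeft_apply] at h_shift
  rw [birkhoffMax, birkhoffMax, partialSups_add_one', bot_eq_zero, birkhoffSum_zero, ← h_shift]
  simp only [Function.comp_def, birkhoffSum_succ']

theorem monotone_birkhoffMax (x : X) : Monotone fun n => birkhoffMax T φ n x :=
  partialSups_monotone _

theorem birkhoffMax_nonneg (n : ℕ) (x : X) : 0 ≤ birkhoffMax T φ n x :=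
  (birkhoffSum_zero T φ x).ge.trans
    (le_partialSups_of_le (fun i => birkhoffSum T φ i x) n.zero_le)

theorem bddAbove_range_birkhoffMax :
    BddAbove (Set.range fun n => birkhoffMax T φ n x) ↔ x ∈ birkhoffBddAbove T φ :=
  bddAbove_range_partialSups

theorem apply_mem_birkhoffBddAbove : T x ∈ birkhoffBddAbove T φ ↔ x ∈ birkhoffBddAbove T φ := by
  constructor
  · rintro ⟨K, hK⟩
    refine ⟨max 0 (φ x + K), ?_⟩
    rintro _ ⟨_ | n, rfl⟩
    · exact le_max_left _ _
    · exact (birkhoffSum_succ' T φ n x).trans_le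
        ((add_le_add_right (hK ⟨n, rfl⟩) _).trans (le_max_right _ _))
  · rintro ⟨K, hK⟩
    refine ⟨K - φ x, ?_⟩
    rintro _ ⟨n, rfl⟩
    exact le_sub_iff_add_le'.mpr ((birkhoffSum_succ' T φ n x).symm.trans_le (hK ⟨n + 1, rfl⟩))

theorem tendsto_max_neg_birkhoffMax (hx : x ∉ birkhoffBddAbove T φ) :
    Tendsto (fun n => max (-birkhoffMax T φ n (T x)) (φ x)) atTop (𝓝 (φ x)) := by
  have h_top : Tendsto (fun n => birkhoffMax T φ n (T x)) atTop atTop :=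
    tendsto_atTop_atTop_of_monotone' (monotone_birkhoffMax (T x))
      (by rwa [bddAbove_range_birkhoffMax, apply_mem_birkhoffBddAbove])
  refine tendsto_const_nhds.congr' ?_
  filter_upwards [h_top.eventually_ge_atTop (-φ x)] with n hn
  exact (max_eq_right (neg_le.mp hn)).symm

variable [MeasurableSpace X] {μ : Measure X}

theorem measurable_birkhoffSum (hT : Measurable T) (hφ : Measurable φ) (n : ℕ) :
    Measurable (birkhoffSum T φ n) :=
  Finset.measurable_fun_sum _ fun i _ => hφ.comp (hT.iterate i)

theorem measurableSet_birkhoffBddAbove (hT : Measurable T) (hφ : Measurable φ) :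
    MeasurableSet (birkhoffBddAbove T φ) :=
  measurableSet_bddAbove_range (measurable_birkhoffSum hT hφ)

theorem nullMeasurableSet_birkhoffBddAbove (hT : Measure.QuasiMeasurePreserving T μ μ)
    (hφ : AEMeasurable φ μ) : NullMeasurableSet (birkhoffBddAbove T φ) μ := by
  refine ⟨birkhoffBddAbove T (hφ.mk φ),
    measurableSet_birkhoffBddAbove hT.measurable hφ.measurable_mk, ?_⟩
  filter_upwards [ae_all_iff.mpr (hT.birkhoffSum_ae_eq_of_ae_eq hφ.ae_eq_mk)] with x hx
  change BddAbove _ = BddAbove _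
  simp only [hx]

theorem integrable_birkhoffMax (hT : MeasurePreserving T μ μ) (hφ : Integrable φ μ) (n : ℕ) :
    Integrable (birkhoffMax T φ n) μ := by
  induction n with
  | zero =>
    have h_zero : birkhoffMax T φ 0 = 0 := by
      funext x
      simp [birkhoffMax]
    exact h_zero ▸ integrable_zero X ℝ μ
  | succ n ih =>
    simp only [funext (birkhoffMax_succ n)]
    exact (integrable_zero X ℝ μ).sup (hφ.add (hT.integrable_comp_of_integrable ih))

theorem integral_max_neg_birkhoffMax_nonneg (hT : MeasurePreserving T μ μ) (hφ : Integrable φ μ)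
    (n : ℕ) : 0 ≤ ∫ x, max (-birkhoffMax T φ n (T x)) (φ x) ∂μ := by
  have h_int := integrable_birkhoffMax hT hφ
  have h_diff (x : X) : max (-birkhoffMax T φ n (T x)) (φ x) =
      birkhoffMax T φ (n + 1) x - birkhoffMax T φ n (T x) := by
    rw [birkhoffMax_succ, ← max_sub_sub_right, zero_sub, add_sub_cancel_right]
  have h_comp : ∫ x, birkhoffMax T φ n (T x) ∂μ = ∫ x, birkhoffMax T φ n x ∂μ := by
    conv_rhs => rw [← hT.map_eq]
    exact (integral_map hT.aemeasurable
      (hT.map_eq.symm ▸ (h_int n).aestronglyMeasurable)).symm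
  simp_rw [h_diff]
  rw [integral_sub (h_int _) (by exact hT.integrable_comp_of_integrable (h_int n)), h_comp,
    sub_nonneg]
  exact integral_mono (h_int n) (h_int (n + 1)) fun x => monotone_birkhoffMax x n.le_succ

-- By ergodicity the Birkhoff sums are a.s. bounded or a.s. unbounded above. In the second case
-- the nonnegative integrals of `max (-M_n ∘ T) φ` converge to the integral of `φ`.
theorem ae_mem_birkhoffBddAbove (hT : Ergodic T μ) (hφ : Integrable φ μ)
    (hneg : ∫ x, φ x ∂μ < 0) : ∀ᵐ x ∂μ, x ∈ birkhoffBddAbove T φ := by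
  refine (hT.quasiErgodic.ae_mem_or_ae_notMem₀
    (nullMeasurableSet_birkhoffBddAbove hT.quasiErgodic.toQuasiMeasurePreserving hφ.aemeasurable)
    (ae_of_all _ fun x => propext apply_mem_birkhoffBddAbove)).resolve_right fun h_unbdd => ?_
  have h_lim : Tendsto (fun n => ∫ x, max (-birkhoffMax T φ n (T x)) (φ x) ∂μ) atTop
      (𝓝 (∫ x, φ x ∂μ)) := by
    refine tendsto_integral_of_dominated_convergence (fun x => |φ x|) (fun n => ?_) hφ.abs
      (fun n => ae_of_all _ fun x => ?_) (h_unbdd.mono fun x => tendsto_max_neg_birkhoffMax)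
    · exact ((hT.toMeasurePreserving.integrable_comp_of_integrable
        (integrable_birkhoffMax hT.toMeasurePreserving hφ n)).neg.sup hφ).aestronglyMeasurable
    · have h_nonneg := birkhoffMax_nonneg (T := T) (φ := φ) n (T x)
      exact abs_le.mpr ⟨(neg_abs_le _).trans (le_max_right _ _),
        max_le ((neg_nonpos.mpr h_nonneg).trans (abs_nonneg _)) (le_abs_self _)⟩
  exact hneg.not_ge (ge_of_tendsto' h_lim
    (integral_max_neg_birkhoffMax_nonneg hT.toMeasurePreserving hφ))

end MaximalErgodic

section Cocycle

open Set

variable {X : Type*} {k : ℕ} {T : X → X} {f : X → (Mat k →ₗ[ℂ] Mat k)}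

/-- The cocycle `f (T^{n-1} x) ∘ ⋯ ∘ f (T x) ∘ f x` generated by `f` over `T`. -/
def cocycle (T : X → X) (f : X → (Mat k →ₗ[ℂ] Mat k)) : ℕ → X → (Mat k →ₗ[ℂ] Mat k)
  | 0, _ => LinearMap.id
  | n + 1, x => f (T^[n] x) ∘ₗ cocycle T f n x

theorem cocycle_succ (n : ℕ) (x : X) :
    cocycle T f (n + 1) x = f (T^[n] x) ∘ₗ cocycle T f n x := rfl

theorem cocycle_add (m n : ℕ) (x : X) :
    cocycle T f (m + n) x = cocycle T f n (T^[m] x) ∘ₗ cocycle T f m x := by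
  induction n with
  | zero => rfl
  | succ n ih =>
    rw [← add_assoc, cocycle_succ, ih, cocycle_succ, LinearMap.comp_assoc,
      ← Function.iterate_add_apply, add_comm n m]

theorem IsPositiveTracePreserving.cocycle (hf : ∀ x, IsPositiveTracePreserving (f x)) (n : ℕ)
    (x : X) : IsPositiveTracePreserving (cocycle T f n x) := by
  induction n with
  | zero => exact .id
  | succ n ih => exact (hf _).comp ih

theorem cocycle_apply_of_equivariant {g : X → Mat k} {Ω : Set X} (hΩ : MapsTo T Ω Ω)
    (hg : ∀ x ∈ Ω, g (T x) = f x (g x)) {x : X} (hx : x ∈ Ω) (n : ℕ) :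
    cocycle T f n x (g x) = g (T^[n] x) := by
  induction n with
  | zero => rfl
  | succ n ih =>
    rw [cocycle_succ, LinearMap.comp_apply, ih, Function.iterate_succ_apply',
      hg _ (hΩ.iterate n hx)]

-- Cut the orbit segment greedily: a visit to `A` starts a block of length `L`, which pays for all
-- the at most `L` visits in it; a point outside `A` is skipped at no cost.
theorem contracts_cocycle_of_visits (hf : ∀ x, IsPositiveTracePreserving (f x)) {β : ℝ}
    (hβ : 0 ≤ β) {L : ℕ} (hL : 0 < L) {A : Set X}
    (hA : ∀ x ∈ A, Contracts (cocycle T f L x) (Real.exp (-(β * L)))) (n : ℕ) (x : X) :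
    Contracts (cocycle T f n x) (Real.exp (β * (L - birkhoffSum T (A.indicator 1) n x))) := by
  have h_visits (i : ℕ) (y : X) : birkhoffSum T (A.indicator (1 : X → ℝ)) i y ≤ i := by
    refine (Finset.sum_le_card_nsmul _ _ 1 fun j _ => ?_).trans_eq (by simp)
    exact indicator_le_self' (fun _ _ => zero_le_one) _
  have h_dens (i : ℕ) (y : X) (ρ : Mat k) (hρ : IsDensity ρ) : IsDensity (cocycle T f i y ρ) :=
    (IsPositiveTracePreserving.cocycle hf i y).map_isDensity hρ
  induction n using Nat.strong_induction_on generalizing x with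
  | _ n ih =>
    obtain hn | hn := le_or_gt n L
    · refine (IsPositiveTracePreserving.cocycle hf n x).contracts_one.mono (Real.one_le_exp ?_)
      exact mul_nonneg hβ (sub_nonneg.mpr ((h_visits n x).trans (Nat.cast_le.mpr hn)))
    by_cases hx : x ∈ A
    · obtain ⟨i, rfl⟩ := Nat.exists_eq_add_of_lt hn
      rw [add_assoc, cocycle_add, birkhoffSum_add]
      refine ((ih (i + 1) (by lia) _).comp (hA x hx) (Real.exp_pos _).le (h_dens L x)).mono ?_
      rw [← Real.exp_add, Real.exp_le_exp]
      linarith [mul_le_mul_of_nonneg_left (h_visits L x) hβ]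
    · obtain ⟨i, rfl⟩ := Nat.exists_eq_add_of_le' (hL.trans hn)
      rw [add_comm i 1, cocycle_add, birkhoffSum_add, birkhoffSum_one, indicator_of_notMem hx,
        zero_add, Function.iterate_one]
      simpa only [mul_one] using (ih i (by lia) (T x)).comp
        (IsPositiveTracePreserving.cocycle hf 1 x).contracts_one (Real.exp_pos _).le (h_dens 1 x)

end Cocycle

section Measurability

open Set Filter Topology

variable {X : Type*} [MeasurableSpace X] {k : ℕ} {g h : X → Mat k} {f : X → (Mat k →ₗ[ℂ] Mat k)}

theorem MatMeasurable.measurableSet_preimage (hg : MatMeasurable g) {s : Set (Mat k)}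
    (hs : IsClosed s) : MeasurableSet (g ⁻¹' s) := by
  have h_entries : Measurable fun x i j => g x i j :=
    measurable_pi_lambda _ fun i => measurable_pi_lambda _ fun j => hg i j
  have h_closed : IsClosed {a : Fin k → Fin k → ℂ | Matrix.of a ∈ s} := hs.preimage continuous_id
  exact h_entries h_closed.measurableSet

theorem MatMeasurable.const (a : Mat k) : MatMeasurable fun _ : X => a :=
  fun _ _ => measurable_const

theorem MatMeasurable.sub (hg : MatMeasurable g) (hh : MatMeasurable h) :
    MatMeasurable fun x => g x - h x := fun i j => (hg i j).sub (hh i j)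

theorem MatMeasurable.piecewise (hg : MatMeasurable g) (hh : MatMeasurable h) {s : Set X}
    (hs : MeasurableSet s) [DecidablePred (· ∈ s)] : MatMeasurable (s.piecewise g h) := by
  intro i j
  simp only [Set.piecewise, apply_ite (fun a : Mat k => a i j)]
  exact (hg i j).ite hs (hh i j)

theorem MatMeasurable.of_tendsto {G : ℕ → X → Mat k} (hG : ∀ n, MatMeasurable (G n))
    (h_lim : ∀ x, Tendsto (fun n => G n x) atTop (𝓝 (g x))) : MatMeasurable g := fun i j =>
  measurable_of_tendsto_metrizable (fun n => hG n i j) <| tendsto_pi_nhds.mpr fun x =>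
    ((continuous_id.matrix_elem i j).tendsto _).comp (h_lim x)

theorem MapMeasurable.apply (hf : MapMeasurable f) (hg : MatMeasurable g) :
    MatMeasurable fun x => f x (g x) := by
  intro i j
  have h_expand (x : X) :
      f x (g x) i j = ∑ a, ∑ b, g x a b * f x (Matrix.single a b 1) i j := by
    conv_lhs => rw [Matrix.matrix_eq_sum_single (g x)]
    have h_single (a b : Fin k) :
        Matrix.single a b (g x a b) = g x a b • Matrix.single a b (1 : ℂ) := by
      rw [Matrix.smul_single, smul_eq_mul, mul_one]
    simp only [h_single, map_sum, map_smul, Matrix.sum_apply, Matrix.smul_apply, smul_eq_mul]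
  simp_rw [h_expand]
  exact Finset.measurable_fun_sum _ fun a _ => Finset.measurable_fun_sum _ fun b _ =>
    (hg a b).mul (hf _ i j)

theorem MapMeasurable.comp_measurable (hf : MapMeasurable f) {Y : Type*} [MeasurableSpace Y]
    {S : Y → X} (hS : Measurable S) : MapMeasurable (f ∘ S) :=
  fun a i j => (hf a i j).comp hS

theorem MapMeasurable.cocycle {T : X → X} (hT : Measurable T) (hf : MapMeasurable f) (n : ℕ) :
    MapMeasurable (cocycle T f n) := by
  induction n with
  | zero => exact .const
  | succ n ih => exact fun a => (hf.comp_measurable (hT.iterate n)).apply (ih a)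

theorem MapMeasurable.measurableSet_minorizes (hf : MapMeasurable f) (ε : ℝ) :
    MeasurableSet {x | Minorizes (f x) ε} := by
  have : SecondCountableTopology (Mat k) :=
    inferInstanceAs (SecondCountableTopology (Fin k → Fin k → ℂ))
  obtain ⟨D, hD_sub, hD, hD_dense⟩ := (TopologicalSpace.IsSeparable.of_separableSpace
    {a : Mat k | a.PosSemidef}).exists_countable_dense_subset
  set Ψ : X → Mat k → Mat k := fun x a => f x a - ((ε : ℂ) * a.trace) • (1 : Mat k)
  have hΨ (x : X) : Continuous (Ψ x) :=
    (f x).continuous_of_finiteDimensional.sub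
      ((continuous_const.mul (continuous_id.matrix_trace)).smul continuous_const)
  have h_eq : {x | Minorizes (f x) ε} = ⋂ a ∈ D, (Ψ · a) ⁻¹' {b | b.PosSemidef} := by
    ext x
    simp only [mem_iInter]
    refine ⟨fun hx a ha => hx a (hD_sub ha), fun hx a ha => ?_⟩
    exact closure_minimal hx (isClosed_posSemidef.preimage (hΨ x)) (hD_dense ha)
  rw [h_eq]
  exact .biInter hD fun a _ =>
    ((hf a).sub (.const _)).measurableSet_preimage isClosed_posSemidef

end Measurability

section StationaryState

open Set Filter Topology
open scoped Matrix.Norms.L2Operator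

variable {k : ℕ}

theorem exists_tendsto_of_antitone_image {Φ : ℕ → (Mat k →ₗ[ℂ] Mat k)} {κ : ℕ → ℝ}
    (hΦ : ∀ j, IsPositiveTracePreserving (Φ j))
    (h_anti : Antitone fun j => Φ j '' {ρ | IsDensity ρ}) (hc : ∀ j, Contracts (Φ j) (κ j))
    (hκ : ∀ j, 0 ≤ κ j) (hκ₀ : Tendsto κ atTop (𝓝 0)) {ρ : Mat k} (hρ : IsDensity ρ) :
    ∃ σ, IsDensity σ ∧ Tendsto (fun j => Φ j ρ) atTop (𝓝 σ) := by
  have h_cauchy : CauchySeq fun j => Φ j ρ := by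
    refine cauchySeq_of_le_tendsto_0' (fun j => 2 * κ j) (fun j l hjl => ?_)
      (by simpa using hκ₀.const_mul 2)
    obtain ⟨σ, hσ, h_eq⟩ := h_anti hjl ⟨ρ, hρ, rfl⟩
    rw [← h_eq, dist_eq_norm]
    exact (norm_le_traceNorm _).trans ((hc j).traceNorm_sub_le (hκ j) hρ hσ)
  obtain ⟨σ, hσ⟩ := cauchySeq_tendsto_of_complete h_cauchy
  exact ⟨σ, (isClosed_isDensity k).mem_of_tendsto hσ
    (Eventually.of_forall fun j => (hΦ j).map_isDensity hρ), hσ⟩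

variable {X : Type*} [MeasurableSpace X] {T : X ≃ᵐ X} {f : X → (Mat k →ₗ[ℂ] Mat k)}

/-- The cocycle `f (T⁻¹ x) ∘ f (T⁻² x) ∘ ⋯ ∘ f (T⁻ⁿ x)` that starts `n` steps in the past of `x` and
ends at `x`. -/
def pullbackCocycle (T : X ≃ᵐ X) (f : X → (Mat k →ₗ[ℂ] Mat k)) (n : ℕ) (x : X) :
    Mat k →ₗ[ℂ] Mat k :=
  cocycle T f n (T.symm^[n] x)

theorem pullbackCocycle_succ (n : ℕ) (x : X) :
    pullbackCocycle T f (n + 1) x = pullbackCocycle T f n x ∘ₗ f (T.symm^[n + 1] x) := by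
  rw [pullbackCocycle, add_comm n 1, cocycle_add, add_comm 1 n, Function.iterate_one,
    Function.iterate_succ_apply' _ n, T.apply_symm_apply]
  rfl

theorem comp_pullbackCocycle (n : ℕ) (x : X) :
    f x ∘ₗ pullbackCocycle T f n x = pullbackCocycle T f (n + 1) (T x) := by
  rw [pullbackCocycle, pullbackCocycle, cocycle_succ, Function.iterate_succ_apply,
    T.symm_apply_apply, (Function.LeftInverse.iterate T.apply_symm_apply n) x]

theorem antitone_image_pullbackCocycle (hf : ∀ x, IsPositiveTracePreserving (f x)) (x : X) :
    Antitone fun n => pullbackCocycle T f n x '' {ρ | IsDensity ρ} := by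
  refine antitone_nat_of_succ_le fun n => ?_
  rw [pullbackCocycle_succ, LinearMap.coe_comp, image_comp]
  exact image_mono (image_subset_iff.mpr fun ρ hρ => (hf _).map_isDensity hρ)

theorem exists_equivariant_isDensity (hk : 0 < k) (hf : MapMeasurable f)
    (hpos : ∀ x, IsPositiveTracePreserving (f x)) {Ω : Set X} (hΩ : MeasurableSet Ω)
    (hTΩ : MapsTo T Ω Ω)
    (hc : ∀ x ∈ Ω, ∃ κ : ℕ → ℝ, (∀ n, 0 ≤ κ n) ∧ Tendsto κ atTop (𝓝 0) ∧
      ∀ n, Contracts (pullbackCocycle T f n x) (κ n)) :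
    ∃ g : X → Mat k, MatMeasurable g ∧ (∀ x, IsDensity (g x)) ∧
      ∀ x ∈ Ω, g (T x) = f x (g x) := by
  classical
  obtain ⟨ρ, hρ⟩ := exists_isDensity hk
  set G : ℕ → X → Mat k := fun n => Ω.piecewise (fun x => pullbackCocycle T f n x ρ) fun _ => ρ
  have hG (n : ℕ) : MatMeasurable (G n) :=
    (((hf.cocycle T.measurable n).comp_measurable (T.symm.measurable.iterate n)) ρ).piecewise
      (.const ρ) hΩ
  have h_lim (x : X) : ∃ σ, IsDensity σ ∧ Tendsto (fun n => G n x) atTop (𝓝 σ) := by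
    by_cases hx : x ∈ Ω
    · obtain ⟨κ, hκ, hκ₀, hcκ⟩ := hc x hx
      simp only [G, piecewise_eq_of_mem _ _ _ hx]
      exact exists_tendsto_of_antitone_image (fun n => .cocycle hpos n _)
        (antitone_image_pullbackCocycle hpos x) hcκ hκ hκ₀ hρ
    · simp only [G, piecewise_eq_of_notMem _ _ _ hx]
      exact ⟨ρ, hρ, tendsto_const_nhds⟩
  choose g hg h_tendsto using h_lim
  refine ⟨g, .of_tendsto hG h_tendsto, hg, fun x hx => ?_⟩
  have h_image := ((f x).continuous_of_finiteDimensional.tendsto _).comp (h_tendsto x)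
  have h_shift := (h_tendsto (T x)).comp (tendsto_add_atTop_nat 1)
  refine tendsto_nhds_unique h_shift (h_image.congr fun n => ?_)
  simp only [G, Function.comp_apply, piecewise_eq_of_mem _ _ _ hx,
    piecewise_eq_of_mem _ _ _ (hTΩ hx), ← comp_pullbackCocycle, LinearMap.comp_apply]

end StationaryState

section TwoSidedOrbits

open MeasureTheory

variable {X : Type*} [MeasurableSpace X] {T : X ≃ᵐ X} {φ : X → ℝ} {x : X}

/-- The points at which the Birkhoff sums of `φ` over the future and over the past are both bounded
above. -/
def orbitBddAbove (T : X ≃ᵐ X) (φ : X → ℝ) : Set X :=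
  birkhoffBddAbove T φ ∩ birkhoffBddAbove T.symm (φ ∘ T.symm)

/-- The supremum of the sums of `φ` over the orbit segments through `x`, written as its past plus
its future part. It is a junk value off `orbitBddAbove T φ`. -/
noncomputable def orbitSup (T : X ≃ᵐ X) (φ : X → ℝ) (x : X) : ℝ :=
  (⨆ a, birkhoffSum T.symm (φ ∘ T.symm) a x) + ⨆ b, birkhoffSum T φ b x

theorem apply_mem_orbitBddAbove : T x ∈ orbitBddAbove T φ ↔ x ∈ orbitBddAbove T φ := by
  have h_past := apply_mem_birkhoffBddAbove (T := T.symm) (φ := φ ∘ T.symm) (x := T x)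
  rw [T.symm_apply_apply] at h_past
  exact and_congr apply_mem_birkhoffBddAbove h_past.symm

theorem birkhoffSum_symm (n : ℕ) (x : X) :
    birkhoffSum T.symm (φ ∘ T.symm) n x = birkhoffSum T φ n (T.symm^[n] x) := by
  induction n with
  | zero => rfl
  | succ n ih =>
    rw [birkhoffSum_succ, birkhoffSum_succ', ih, Function.comp_apply,
      Function.iterate_succ_apply', T.apply_symm_apply, add_comm]

theorem birkhoffSum_le_orbitSup (hx : x ∈ orbitBddAbove T φ) (a b : ℕ) :
    birkhoffSum T φ (a + b) (T.symm^[a] x) ≤ orbitSup T φ x := by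
  rw [birkhoffSum_add, ← birkhoffSum_symm,
    (Function.LeftInverse.iterate T.apply_symm_apply a) x]
  exact add_le_add (le_ciSup hx.2 a) (le_ciSup hx.1 b)

theorem measurableSet_orbitBddAbove (hφ : Measurable φ) : MeasurableSet (orbitBddAbove T φ) :=
  (measurableSet_birkhoffBddAbove T.measurable hφ).inter
    (measurableSet_birkhoffBddAbove T.symm.measurable (hφ.comp T.symm.measurable))

theorem measurable_orbitSup (hφ : Measurable φ) : Measurable (orbitSup T φ) :=
  (Measurable.iSup fun a =>
    measurable_birkhoffSum T.symm.measurable (hφ.comp T.symm.measurable) a).add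
    (Measurable.iSup fun b => measurable_birkhoffSum T.measurable hφ b)

theorem ae_mem_orbitBddAbove {μ : Measure X} (hT : Ergodic T μ) (hφ : Integrable φ μ)
    (hneg : ∫ x, φ x ∂μ < 0) : ∀ᵐ x ∂μ, x ∈ orbitBddAbove T φ := by
  have h_symm : MeasurePreserving T.symm μ μ := hT.symm.toMeasurePreserving
  filter_upwards [ae_mem_birkhoffBddAbove hT hφ hneg,
    ae_mem_birkhoffBddAbove hT.symm (h_symm.integrable_comp_of_integrable hφ)
      ((h_symm.integral_comp' φ).trans_lt hneg)] with x h_future h_past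
  exact ⟨h_future, h_past⟩

theorem iterate_zpow_apply (n : ℕ) (z : ℤ) (x : X) :
    T^[n] ((T.toEquiv ^ z : Equiv.Perm X) x) = (T.toEquiv ^ (z + n) : Equiv.Perm X) x := by
  rw [add_comm, zpow_add, zpow_natCast, Equiv.Perm.mul_apply, ← Equiv.Perm.iterate_eq_pow]
  rfl

theorem symm_iterate_zpow_apply (n : ℕ) (z : ℤ) (x : X) :
    T.symm^[n] ((T.toEquiv ^ z : Equiv.Perm X) x) = (T.toEquiv ^ (z - n) : Equiv.Perm X) x := by
  rw [← sub_add_cancel z n, ← iterate_zpow_apply, sub_add_cancel,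
    (Function.LeftInverse.iterate T.symm_apply_apply n) _]

theorem orbitSeq_comp_self {Y : Type*} (g : X → Y) {z n : ℤ} (hzn : z ≤ n) (x : X) :
    orbitSeq T (g ∘ T) n x = g (T^[(n + 1 - z).toNat] ((T.toEquiv ^ z : Equiv.Perm X) x)) := by
  rw [iterate_zpow_apply, Int.toNat_of_nonneg (by lia), add_sub_cancel, ← Nat.cast_one,
    ← iterate_zpow_apply, Function.iterate_one, orbitSeq, Function.comp_apply]

theorem measurePreserving_zpow {μ : Measure X} (hT : MeasurePreserving T μ μ) (z : ℤ) :
    MeasurePreserving (T.toEquiv ^ z : Equiv.Perm X) μ μ := by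
  obtain ⟨n, rfl | rfl⟩ := z.eq_nat_or_neg
  · convert hT.iterate n using 1
    funext x
    simpa using (iterate_zpow_apply n 0 x).symm
  · convert (hT.symm T).iterate n using 1
    funext x
    simpa using (symm_iterate_zpow_apply n 0 x).symm

variable {k : ℕ} (f : X → (Mat k →ₗ[ℂ] Mat k))

theorem compUp_orbitSeq (m : ℤ) (j : ℕ) (x : X) :
    compUp (fun i => orbitSeq T f i x) m j =
      cocycle T f (j + 1) ((T.toEquiv ^ m : Equiv.Perm X) x) := by
  induction j with
  | zero => rfl
  | succ j ih => rw [compUp, ih, cocycle_succ (j + 1), iterate_zpow_apply, orbitSeq]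

theorem compRange_orbitSeq_zero (n : ℕ) (x : X) :
    compRange (fun i => orbitSeq T f i x) n 0 = cocycle T f (n + 1) x := by
  rw [compRange, compUp_orbitSeq, sub_zero, Int.toNat_natCast, zpow_zero, Equiv.Perm.one_apply]

theorem compRange_orbitSeq {m z n : ℤ} (hmz : m ≤ z) (hzn : z ≤ n) (x : X) :
    compRange (fun i => orbitSeq T f i x) n m =
      cocycle T f ((z - m).toNat + (n + 1 - z).toNat)
        (T.symm^[(z - m).toNat] ((T.toEquiv ^ z : Equiv.Perm X) x)) := by
  rw [compRange, compUp_orbitSeq, symm_iterate_zpow_apply, Int.toNat_of_nonneg (by lia),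
    sub_sub_cancel, show (n - m).toNat + 1 = (z - m).toNat + (n + 1 - z).toNat by lia]

end TwoSidedOrbits

section ExponentialDecay

open MeasureTheory Filter Topology Set

variable {X : Type*} [MeasurableSpace X] {μ : Measure X} {k : ℕ} {f : X → (Mat k →ₗ[ℂ] Mat k)}

-- `ψ` is `-kε/L` times the indicator of the points from which the block of length `L` satisfies
-- Doeblin's condition with constant `ε`.
theorem exists_contracts_cocycle_exp_birkhoffSum [IsFiniteMeasure μ] {T : X → X}
    (hT : Measurable T) (hk : 0 < k) (hf : MapMeasurable f)
    (hpos : ∀ x, IsPositiveTracePreserving (f x)) {L : ℕ} (hL : 0 < L)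
    (hstrict : 0 < μ {x | IsStrictPos (cocycle T f L x)}) :
    ∃ (C : ℝ) (ψ : X → ℝ), Measurable ψ ∧ Integrable ψ μ ∧ ∫ x, ψ x ∂μ < 0 ∧
      ∀ n x, Contracts (cocycle T f n x) (Real.exp (C + birkhoffSum T ψ n x)) := by
  obtain ⟨ε, hε, hA_pos⟩ := exists_pos_measure_minorizes hstrict
  set A : Set X := {x | Minorizes (cocycle T f L x) ε}
  have hA : MeasurableSet A := (hf.cocycle hT L).measurableSet_minorizes ε
  have hA_real : 0 < μ.real A := ENNReal.toReal_pos hA_pos.ne' (measure_ne_top μ A)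
  have hL' : (0 : ℝ) < L := Nat.cast_pos.mpr hL
  set β : ℝ := k * ε / L with hβ_def
  have hβ : 0 < β := div_pos (mul_pos (Nat.cast_pos.mpr hk) hε) hL'
  have h_block : ∀ x ∈ A, Contracts (cocycle T f L x) (Real.exp (-(β * L))) := fun x hx => by
    rw [hβ_def, div_mul_cancel₀ _ hL'.ne']
    exact (Minorizes.contracts hx (IsPositiveTracePreserving.cocycle hpos L x).trace_map).mono
      (Real.one_sub_le_exp_neg _)
  refine ⟨β * L, fun x => -β * A.indicator 1 x, (measurable_one.indicator hA).const_mul _,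
    ((integrable_const 1).indicator hA).const_mul _, ?_, fun n x => ?_⟩
  · rw [integral_const_mul, integral_indicator_one hA]
    exact mul_neg_of_neg_of_pos (neg_neg_of_pos hβ) hA_real
  · have h_sum : birkhoffSum T (fun x => -β * A.indicator 1 x) n x =
        -β * birkhoffSum T (A.indicator 1) n x := (Finset.mul_sum _ _ _).symm
    convert contracts_cocycle_of_visits hpos hβ.le hL h_block n x using 2
    rw [h_sum]
    ring

variable {T : X ≃ᵐ X} {φ : X → ℝ} {α C : ℝ}

theorem contracts_cocycle_of_mem_orbitBddAbove {x : X} (hx : x ∈ orbitBddAbove T φ)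
    (hc : ∀ n x, Contracts (cocycle T f n x) (Real.exp (C + birkhoffSum T φ n x - α * n)))
    (a b : ℕ) :
    Contracts (cocycle T f (a + b) (T.symm^[a] x))
      (Real.exp (C + orbitSup T φ x) * Real.exp (-(α * (a + b : ℕ)))) := by
  refine (hc (a + b) (T.symm^[a] x)).mono ?_
  rw [← Real.exp_add, ← sub_eq_add_neg, Real.exp_le_exp]
  gcongr
  exact birkhoffSum_le_orbitSup hx a b

theorem tendsto_mul_exp_neg_mul_natCast (hα : 0 < α) (K : ℝ) :
    Tendsto (fun n : ℕ => K * Real.exp (-(α * n))) atTop (𝓝 0) := by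
  have h_exp := Real.tendsto_exp_neg_atTop_nhds_zero.comp
    (tendsto_natCast_atTop_atTop.const_mul_atTop hα)
  simpa using h_exp.const_mul K

open Classical in
/-- The random constant of the exponential decay: finite exactly where the Birkhoff sums of `φ` over
past and future are bounded above. -/
noncomputable def decayConstant (T : X ≃ᵐ X) (φ : X → ℝ) (C : ℝ) : X → ENNReal :=
  (orbitBddAbove T φ).piecewise (fun x => ENNReal.ofReal (2 * Real.exp (C + orbitSup T φ x))) ⊤

theorem measurable_decayConstant (hφ : Measurable φ) : Measurable (decayConstant T φ C) :=
  Measurable.piecewise (measurableSet_orbitBddAbove hφ)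
    ((((measurable_orbitSup hφ).const_add C).exp).const_mul 2).ennreal_ofReal measurable_const

theorem decayConstant_of_mem {x : X} (hx : x ∈ orbitBddAbove T φ) :
    decayConstant T φ C x = ENNReal.ofReal (2 * Real.exp (C + orbitSup T φ x)) := by
  classical
  exact piecewise_eq_of_mem _ _ _ hx

theorem decayConstant_of_notMem {x : X} (hx : x ∉ orbitBddAbove T φ) :
    decayConstant T φ C x = ⊤ := by
  classical
  exact piecewise_eq_of_notMem _ _ _ hx

theorem decayConstant_lt_top {x : X} (hx : x ∈ orbitBddAbove T φ) :
    decayConstant T φ C x < ⊤ := by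
  rw [decayConstant_of_mem hx]
  exact ENNReal.ofReal_lt_top

theorem ofReal_traceNorm_cocycle_sub_le
    (hc : ∀ n x, Contracts (cocycle T f n x) (Real.exp (C + birkhoffSum T φ n x - α * n)))
    {g : X → Mat k} (hg : ∀ x, IsDensity (g x))
    (h_equiv : ∀ x ∈ orbitBddAbove T φ, g (T x) = f x (g x)) {ρ : Mat k} (hρ : IsDensity ρ)
    (x : X) (a b : ℕ) :
    ENNReal.ofReal (traceNorm (cocycle T f (a + b) (T.symm^[a] x) ρ - g (T^[b] x))) ≤
      decayConstant T φ C x * ENNReal.ofReal (Real.exp (-(α * (a + b : ℕ)))) := by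
  by_cases hx : x ∈ orbitBddAbove T φ
  · have h_past : T.symm^[a] x ∈ orbitBddAbove T φ := by
      refine MapsTo.iterate (fun y hy => ?_) a hx
      rwa [← apply_mem_orbitBddAbove, T.apply_symm_apply]
    have h_image := cocycle_apply_of_equivariant (fun y => apply_mem_orbitBddAbove.mpr) h_equiv
      h_past (a + b)
    rw [add_comm a b, Function.iterate_add_apply,
      (Function.LeftInverse.iterate T.apply_symm_apply a) x] at h_image
    rw [decayConstant_of_mem hx, ← ENNReal.ofReal_mul (by positivity), ← h_image,
      add_comm b a, mul_assoc]
    have h_contracts := contracts_cocycle_of_mem_orbitBddAbove hx hc a b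
    exact ENNReal.ofReal_le_ofReal (h_contracts.traceNorm_sub_le (by positivity) hρ (hg _))
  · rw [decayConstant_of_notMem hx,
      ENNReal.top_mul (ENNReal.ofReal_pos.mpr (Real.exp_pos _)).ne']
    exact le_top

theorem exists_isDensity_exp_decay [IsProbabilityMeasure μ] (hT : Ergodic T μ) (hk : 0 < k)
    (hf : MapMeasurable f) (hpos : ∀ x, IsPositiveTracePreserving (f x)) {L : ℕ} (hL : 0 < L)
    (hstrict : 0 < μ {x | IsStrictPos (cocycle T f L x)}) :
    ∃ (α : ℝ) (g : X → Mat k) (D : X → ENNReal), 0 < α ∧ MatMeasurable g ∧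
      (∀ x, IsDensity (g x)) ∧ Measurable D ∧ (∀ᵐ x ∂μ, D x < ⊤) ∧
      ∀ (x : X) (a b : ℕ) (ρ : Mat k), IsDensity ρ →
        ENNReal.ofReal (traceNorm (cocycle T f (a + b) (T.symm^[a] x) ρ - g (T^[b] x))) ≤
          D x * ENNReal.ofReal (Real.exp (-(α * (a + b : ℕ)))) := by
  obtain ⟨C, ψ, hψ, hψ_int, hψ_neg, hc⟩ := exists_contracts_cocycle_exp_birkhoffSum
    T.measurable hk hf hpos hL hstrict
  obtain ⟨α, hα, hα_lt⟩ : ∃ α > 0, α < -∫ x, ψ x ∂μ := exists_between (neg_pos.mpr hψ_neg)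
  set φ : X → ℝ := ψ + fun _ => α
  have hφ : Measurable φ := hψ.add_const α
  have hφ_int : Integrable φ μ := hψ_int.add (integrable_const α)
  have hφ_neg : ∫ x, φ x ∂μ < 0 := by
    rw [integral_add' hψ_int (integrable_const α), integral_const, probReal_univ, one_smul]
    linarith
  have hcφ (n : ℕ) (x : X) :
      Contracts (cocycle T f n x) (Real.exp (C + birkhoffSum T φ n x - α * n)) := by
    have h_const : birkhoffSum T (fun _ => α) n x = α * n := by simp [birkhoffSum, mul_comm]
    convert hc n x using 2
    rw [birkhoffSum_add', h_const]
    ring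
  obtain ⟨g, hg, hgd, h_equiv⟩ := exists_equivariant_isDensity hk hf hpos
    (measurableSet_orbitBddAbove hφ) (fun x => apply_mem_orbitBddAbove.mpr) fun x hx =>
      ⟨_, fun n => by positivity, tendsto_mul_exp_neg_mul_natCast hα _,
        fun n => contracts_cocycle_of_mem_orbitBddAbove hx hcφ n 0⟩
  exact ⟨α, g, decayConstant T φ C, hα, hg, hgd, measurable_decayConstant hφ,
    (ae_mem_orbitBddAbove hT hφ_int hφ_neg).mono fun x => decayConstant_lt_top,
    fun x a b ρ hρ => ofReal_traceNorm_cocycle_sub_le hcφ hgd h_equiv hρ x a b⟩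

end ExponentialDecay

theorem mainTheorem2_general {X : Type*} [MeasurableSpace X] (P : MeasureTheory.Measure X)
    [MeasureTheory.IsProbabilityMeasure P] (T : X ≃ᵐ X) (hT : Ergodic T P)
    (k : ℕ) (hk : 0 < k) (f₀ : X → (Mat k →ₗ[ℂ] Mat k)) (hf₀ : MapMeasurable f₀)
    (hpos : ∀ x, IsPositiveTracePreserving (f₀ x)) (N : ℕ)
    (hstrict : 0 < P {x | IsStrictPos (compRange (fun n => orbitSeq T f₀ n x) (N : ℤ) 0)}) :
    ∃ α : ℝ, 0 < α ∧ ∃ g₀ : X → Mat k, MatMeasurable g₀ ∧ (∀ x, IsDensity (g₀ x)) ∧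
      ∃ C : ℤ → X → ENNReal, (∀ z, Measurable (C z)) ∧ (∀ z, ∀ᵐ x ∂P, C z x < ⊤) ∧
        ∀ m z n : ℤ, m ≤ z → z ≤ n → ∀ x : X, ∀ ρ : Mat k, IsDensity ρ →
          ENNReal.ofReal
              (traceNorm (compRange (fun i => orbitSeq T f₀ i x) n m ρ - orbitSeq T g₀ n x)) ≤
            C z x * ENNReal.ofReal (Real.exp (-α * ((n - m : ℤ) : ℝ))) := by
  simp only [compRange_orbitSeq_zero] at hstrict
  obtain ⟨α, g, D, hα, hg, hgd, hD, hD_fin, h_decay⟩ :=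
    exists_isDensity_exp_decay hT hk hf₀ hpos N.succ_pos hstrict
  have h_zpow (z : ℤ) := measurePreserving_zpow hT.toMeasurePreserving z
  refine ⟨α, hα, g ∘ T, fun i j => (hg i j).comp T.measurable, fun x => hgd (T x),
    fun z x => D ((T.toEquiv ^ z : Equiv.Perm X) x), fun z => hD.comp (h_zpow z).measurable,
    fun z => (h_zpow z).quasiMeasurePreserving.ae hD_fin, fun m z n hmz hzn x ρ hρ => ?_⟩
  rw [compRange_orbitSeq f₀ hmz hzn, orbitSeq_comp_self g hzn]
  refine (h_decay _ _ _ ρ hρ).trans ?_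
  have h_time : ((n - m : ℤ) : ℝ) ≤ ((z - m).toNat + (n + 1 - z).toNat : ℕ) := by
    exact_mod_cast (by lia : n - m ≤ (((z - m).toNat + (n + 1 - z).toNat : ℕ) : ℤ))
  rw [neg_mul]
  gcongr

theorem mainTheorem2 {X : Type*} [MeasurableSpace X] (P : MeasureTheory.Measure X)
    [MeasureTheory.IsProbabilityMeasure P] (T : X ≃ᵐ X) (hT : Ergodic T P)
    (k : ℕ) (hk : 0 < k)
    (f₀ : X → (Mat k →ₗ[ℂ] Mat k)) (hf₀ : MapMeasurable f₀) (hchan : ∀ x, IsChannel (f₀ x))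
    (N : ℕ) (hN : 0 < N)
    (hpos : 0 < P {x | IsStrictPos (compRange (fun n => orbitSeq T f₀ n x) (N : ℤ) 0)})
    (hker : P {x | {a : Mat k | dualMap (f₀ x) a = 0} ∩ {a : Mat k | a.PosSemidef} = {0}} = 1) :
    ∃ α : ℝ, 0 < α ∧ ∃ g₀ : X → Mat k, MatMeasurable g₀ ∧ (∀ x, IsDensity (g₀ x)) ∧
      ∃ C : ℤ → X → ENNReal, (∀ z, Measurable (C z)) ∧ (∀ z, ∀ᵐ x ∂P, C z x < ⊤) ∧
        ∀ m z n : ℤ, m < n → m ≤ z → z ≤ n → ∀ x : X, ∀ ρ : Mat k, IsDensity ρ →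
          ENNReal.ofReal
              (traceNorm (compRange (fun i => orbitSeq T f₀ i x) n m ρ - orbitSeq T g₀ n x)) ≤
            C z x * ENNReal.ofReal (Real.exp (-α * ((n - m : ℤ) : ℝ))) := by
  obtain ⟨α, hα, g₀, hg, hgd, C, hC, hC_fin, h_bound⟩ := mainTheorem2_general P T hT k hk f₀ hf₀
    (fun x => (hchan x).isPositiveTracePreserving) N hpos
  exact ⟨α, hα, g₀, hg, hgd, C, hC, hC_fin, fun m z n _ => h_bound m z n⟩
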